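/- **Preliminaries.** A *bipolar set-argumentation framework* (BSAF) is a tuple $F=(A,R,S)$ with $A$ a finite set of arguments and $R,S\subseteq 2^A\times A$ (attacks and supports; a link $(T,h)$ has tail $T$ and head $h$, and tails may be empty unless excluded below). For a set $Q$ of links put $E^+_Q=\{h\mid \exists T\subseteq E:(T,h)\in Q\}$. Let $\mathit{supp}_S(E)=E\cup\{h\mid\exists (T,h)\in S: T\subseteq E\}$ and $\mathit{cl}_S(E)=\bigcup_{i\ge1}\mathit{supp}_S^i(E)$; $E$ is closed in $F$ if $\mathit{cl}_S(E)=E$. A set $E$ attacks $E'$ if $E^+_R\cap E'\neq\emptyset$. A set $E\subseteq A$ is admissible, $E\in\mathit{adm}(F)$, if it does not attack itself, is closed, and defends each $a\in E$, where $E$ defends $a$ if $E$ attacks every closed $E'\subseteq A$ with $a\in E'^+_R$. An admissible $E$ is in $\mathit{com}(F)$ if it contains every $a\in A$ it defends, and in $\mathit{stb}(F)$ if $A\setminus E\subseteq E^+_R$. A *splitting* of $F=(A,R,S)$ is a tuple $(F_1,F_2,R_3,S_3)$ where $F_i=(A_i,R_i,S_i)$ ($i=1,2$) are BSAFs contained componentwise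 in $F$, $A_1\cap A_2=\emptyset$, $A=A_1\cup A_2$, $R=R_1\cup R_2\cup R_3$, $S=S_1\cup S_2\cup S_3$, every $(T,h)\in R_3$ is an attack of $F$ with $T\cap A_1\ne\emptyset$, $h\in A_2$, and every $(T,h)\in S_3$ is a support of $F$ with $T\cap A_2\neq\emptyset$, $h\in A_1$. Let $*_0,*_1,*_2$ be pairwise distinct and not in $A$. **The modified second framework.** Given $E_1\subseteq A_1$, define $F_2^\circledast$ as follows. 1. (Closing attacks) For $i=2,3$ let $R_i^c=\{(\mathit{cl}_S(T),h)\mid (T,h)\in R_i\}$; let $\hat R_2=\{(T,h)\in R_2^c\mid T\cap A_1=\emptyset\}$ and $\hat R_3=\{(T,h)\in R_2^c\cup R_3^c\mid T\cap A_1\ne\emptyset\}$. 2. (R-reduct) Let $\hat R_2^{E_1}=\hat R_2\cup\{(T\cap A_2,h)\mid (T,h)\in\hat R_3,\ T\cap (E_1)^+_{R_1\cup\hat R_3}=\emptyset,\ T\cap A_1\subseteq E_1\}$. 3. ($*_0$-modification) Let $U=\{(T,h)\in\hat R_3\mid T\cap (E_1)^+_{R_1\cup\hat R_2\cup\hat R_3}=\emptyset,\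 T\cap A_1\not\subseteq E_1\}$. If $U=\emptyset$, let $F_2^\star=(A_2,\hat R_2^{E_1},S_2)$; otherwise let $F_2^\star=(A_2\cup\{*_0\},\ \hat R_2^{E_1}\cup\{(\{*_0\},*_0)\}\cup\{((T\cap A_2)\cup\{*_0\},h)\mid (T,h)\in U\},\ S_2)$. Write $F_2^\star=(A_2^\star,R_2^\star,S_2)$. 4. (S-reduct) Let $\mathcal T=\{T\mid\exists h\in A_1:(T,h)\in S_3,\ T\cap A_1\subseteq E_1,\ h\notin E_1\}$ and $\mathcal D=\{T\in\mathcal T\mid T\cap A_1=\emptyset,\ \mathit{cl}_S(T)\cap (E_1)^+_{R_1\cup R_2^\star}\ne\emptyset\}$. Then $F_2^\circledast$ is obtained from $F_2^\star$ by adding: if $\mathcal D\neq\emptyset$, the argument $*_1$, the attack $(\emptyset,*_1)$ and the supports $(T\cap A_2,*_1)$ for $T\in\mathcal D$; and, if $\mathcal T\setminus\mathcal D\ne\emptyset$, the argument $*_2$ and, for $T\in\mathcal T\setminus\mathcal D$, the attacks $((T\cap A_2)\cup\{*_2\},*_2)$ and the supports $(T\cap A_2,*_2)$. **Theorem (general splitting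 theorem).** Let $(F_1,F_2,R_3,S_3)$ be a splitting of a BSAF $F=(A,R,S)$ such that no support in $S_2$ has an empty tail, and let $\sigma\in\{\mathit{stb},\mathit{adm},\mathit{com}\}$. 1. If $E_1\in\sigma(F_1)$ and $E_2\in\sigma(F_2^\circledast)$, with $F_2^\circledast$ built from $E_1$, then $E_1\cup(E_2\setminus\{*_2\})\in\sigma(F)$. 2. If $E\in\sigma(F)$, then $E_1:=E\cap A_1\in\sigma(F_1)$ and, with $F_2^\circledast$ built from this $E_1$, $E\cap A_2\in\sigma(F_2^\circledast)$ or $(E\cap A_2)\cup\{*_2\}\in\sigma(F_2^\circledast)$. -/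

import Mathlib

/-- A link `(T, h)` with tail `T` and head `h`; the tail may be empty. -/
abbrev Link (α : Type*) := Set α × α

/-- Bipolar set-argumentation framework: a finite set `A` of arguments with an attack relation
`R ⊆ 2^A × A` and a support relation `S ⊆ 2^A × A`. -/
@[ext] structure BSAF (α : Type*) where
  A : Set α
  R : Set (Link α)
  S : Set (Link α)
  finite_A : A.Finite
  R_sub : ∀ p ∈ R, p.1 ⊆ A ∧ p.2 ∈ A
  S_sub : ∀ p ∈ S, p.1 ⊆ A ∧ p.2 ∈ A

namespace BSAF

variable {α : Type*}

/-- One step of support: `E ∪ {h | ∃ (T, h) ∈ S, T ⊆ E}`. (Heads of supports of a framework are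
always arguments of it.) -/
def supp (S : Set (Link α)) (E : Set α) : Set α :=
  E ∪ {h | ∃ T, (T, h) ∈ S ∧ T ⊆ E}

/-- The closure `⋃_{i ≥ 1} supp^i (E)`. -/
def cl (S : Set (Link α)) (E : Set α) : Set α :=
  ⋃ i ∈ Set.Ici (1 : ℕ), (supp S)^[i] E

/-- The set `E⁺` of arguments attacked by `E`. -/
def plus (R : Set (Link α)) (E : Set α) : Set α :=
  {h | ∃ T, (T, h) ∈ R ∧ T ⊆ E}

/-- `E` attacks some member of `E'`. -/
def AttacksSet (R : Set (Link α)) (E E' : Set α) : Prop :=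
  (plus R E ∩ E').Nonempty

/-- `E` is closed in `F`. -/
def IsClosedIn (F : BSAF α) (E : Set α) : Prop := cl F.S E = E

/-- `E` defends `a`: `E` attacks every closed set of arguments that attacks `a`. -/
def Defends (F : BSAF α) (E : Set α) (a : α) : Prop :=
  ∀ E' ⊆ F.A, F.IsClosedIn E' → a ∈ plus F.R E' → AttacksSet F.R E E'

/-- Conflict-free sets. -/
def cf (F : BSAF α) : Set (Set α) := {E | E ⊆ F.A ∧ ¬ AttacksSet F.R E E}

/-- Admissible sets. -/
def adm (F : BSAF α) : Set (Set α) :=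
  {E | E ∈ F.cf ∧ F.IsClosedIn E ∧ ∀ a ∈ E, F.Defends E a}

/-- Complete extensions. -/
def com (F : BSAF α) : Set (Set α) :=
  {E | E ∈ F.adm ∧ ∀ a ∈ F.A, F.Defends E a → a ∈ E}

/-- Stable extensions. -/
def stb (F : BSAF α) : Set (Set α) :=
  {E | E ∈ F.adm ∧ ∀ a ∈ F.A \ E, a ∈ plus F.R E}

/-- Sub-framework (componentwise inclusion). -/
def IsSub (F₁ F : BSAF α) : Prop := F₁.A ⊆ F.A ∧ F₁.R ⊆ F.R ∧ F₁.S ⊆ F.S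

/-- `(F₁, F₂, R₃, S₃)` is a splitting of `F`: shared attacks point forward (into `F₂`), shared
supports point backward (into `F₁`). -/
structure IsSplitting (F F₁ F₂ : BSAF α) (R₃ S₃ : Set (Link α)) : Prop where
  sub₁ : F₁.IsSub F
  sub₂ : F₂.IsSub F
  disj : F₁.A ∩ F₂.A = ∅
  A_eq : F.A = F₁.A ∪ F₂.A
  R_eq : F.R = F₁.R ∪ F₂.R ∪ R₃
  S_eq : F.S = F₁.S ∪ F₂.S ∪ S₃
  R₃_sub : R₃ ⊆ {p | p ∈ F.R ∧ (p.1 ∩ F₁.A).Nonempty ∧ p.1 ⊆ F.A ∧ p.2 ∈ F₂.A}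
  S₃_sub : S₃ ⊆ {p | p ∈ F.S ∧ (p.1 ∩ F₂.A).Nonempty ∧ p.1 ⊆ F.A ∧ p.2 ∈ F₁.A}

/-- Closed links: the tail of each link is replaced by its closure under `S`. -/
def closeLinks (S Q : Set (Link α)) : Set (Link α) :=
  {p | ∃ T h, (T, h) ∈ Q ∧ p = (cl S T, h)}

/-- The `(E₁, Q)`-reduct (R-reduct) of `F₂`, for a set `Q` of closed negative links from `F₁`
into `F₂`. -/
def rReduct (F₁ F₂ : BSAF α) (Q : Set (Link α)) (hQ : ∀ p ∈ Q, p.2 ∈ F₂.A) (E₁ : Set α) :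
    BSAF α where
  A := F₂.A
  R := F₂.R ∪ {p | ∃ T h, (T, h) ∈ Q ∧ T ∩ plus (F₁.R ∪ Q) E₁ = ∅ ∧ T ∩ F₁.A ⊆ E₁ ∧
    p = (T ∩ F₂.A, h)}
  S := F₂.S
  finite_A := F₂.finite_A
  R_sub := by
    rintro p (hp | ⟨T, h, hT, -, -, rfl⟩)
    · exact F₂.R_sub p hp
    · exact ⟨Set.inter_subset_right, hQ (T, h) hT⟩
  S_sub := F₂.S_sub

/-- The undecided links among the negative links `Q` of the attack splitting `(F₁, F₂, Q)`;
the attack relation of the split framework is `R₁ ∪ R₂ ∪ Q`. -/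
def undecided (F₁ F₂ : BSAF α) (Q : Set (Link α)) (E₁ : Set α) : Set (Link α) :=
  {p | p ∈ Q ∧ p.1 ∩ plus (F₁.R ∪ F₂.R ∪ Q) E₁ = ∅ ∧ ¬ p.1 ∩ F₁.A ⊆ E₁}

/-- The modification of `G` (an R-reduct) by a set `U` of undecided links. If `U = ∅` this is `G`
itself. Otherwise the self-attacking argument `s₀` is added, and each undecided
link `(T, h)` becomes the attack `((T ∩ A₂) ∪ {s₀}, h)`. -/
def modification (G : BSAF α) (U : Set (Link α)) (hU : ∀ p ∈ U, p.2 ∈ G.A) (s₀ : α) :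
    BSAF α where
  A := G.A ∪ {x | U.Nonempty ∧ x = s₀}
  R := G.R ∪ {p | U.Nonempty ∧ p = ({s₀}, s₀)} ∪
    {p | ∃ T h, (T, h) ∈ U ∧ p = ((T ∩ G.A) ∪ {s₀}, h)}
  S := G.S
  finite_A := G.finite_A.union ((Set.finite_singleton s₀).subset fun _ hx => hx.2)
  R_sub := by
    rintro p ((hp | ⟨hne, rfl⟩) | ⟨T, h, hT, rfl⟩)
    · exact ⟨(G.R_sub p hp).1.trans Set.subset_union_left, Or.inl (G.R_sub p hp).2⟩
    · exact ⟨by rintro x rfl; exact Or.inr ⟨hne, rfl⟩, Or.inr ⟨hne, rfl⟩⟩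
    · refine ⟨?_, Or.inl (hU (T, h) hT)⟩
      rintro x (hx | rfl)
      · exact Or.inl hx.2
      · exact Or.inr ⟨⟨_, hT⟩, rfl⟩
  S_sub := fun p hp =>
    ⟨(G.S_sub p hp).1.trans Set.subset_union_left, Or.inl (G.S_sub p hp).2⟩

/-- Tails of shared supports that are support-incompatible with `E₁`. -/
def incompatible (F₁ : BSAF α) (S₃ : Set (Link α)) (E₁ : Set α) : Set (Set α) :=
  {T | ∃ h ∈ F₁.A, (T, h) ∈ S₃ ∧ T ∩ F₁.A ⊆ E₁ ∧ h ∉ E₁}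

/-- Tails of shared supports that are closure-defeated with respect to `E₁`; the closure and the
attacks are those of the framework `(A₁ ∪ A₂, R₁ ∪ R₂, S₁ ∪ S₂ ∪ S₃)` split by
`(F₁, F₂, S₃)`. -/
def closureDefeated (F₁ F₂ : BSAF α) (S₃ : Set (Link α)) (E₁ : Set α) : Set (Set α) :=
  {T | T ∈ incompatible F₁ S₃ E₁ ∧ T ∩ F₁.A = ∅ ∧
    (cl (F₁.S ∪ F₂.S ∪ S₃) T ∩ plus (F₁.R ∪ F₂.R) E₁).Nonempty}

/-- Type-1-modification of `F₂` for a collection `D` of tails: add `s₁`, attacked by the empty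
set and supported by each `T ∩ A₂`, `T ∈ D`. If `D = ∅` this is `F₂`. -/
def typeOne (F₂ : BSAF α) (D : Set (Set α)) (s₁ : α) : BSAF α where
  A := F₂.A ∪ {x | D.Nonempty ∧ x = s₁}
  R := F₂.R ∪ {p | D.Nonempty ∧ p = (∅, s₁)}
  S := F₂.S ∪ {p | ∃ T ∈ D, p = (T ∩ F₂.A, s₁)}
  finite_A := F₂.finite_A.union ((Set.finite_singleton s₁).subset fun _ hx => hx.2)
  R_sub := by
    rintro p (hp | ⟨hne, rfl⟩)
    · exact ⟨(F₂.R_sub p hp).1.trans Set.subset_union_left, Or.inl (F₂.R_sub p hp).2⟩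
    · exact ⟨Set.empty_subset _, Or.inr ⟨hne, rfl⟩⟩
  S_sub := by
    rintro p (hp | ⟨T, hT, rfl⟩)
    · exact ⟨(F₂.S_sub p hp).1.trans Set.subset_union_left, Or.inl (F₂.S_sub p hp).2⟩
    · exact ⟨fun x hx => Or.inl hx.2, Or.inr ⟨⟨T, hT⟩, rfl⟩⟩

/-- Type-2-modification of `F₂` for a collection `D` of tails: add `s₂`, attacked by each
`(T ∩ A₂) ∪ {s₂}` and supported by each `T ∩ A₂`, `T ∈ D`. If `D = ∅` this is `F₂`. -/
def typeTwo (F₂ : BSAF α) (D : Set (Set α)) (s₂ : α) : BSAF α where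
  A := F₂.A ∪ {x | D.Nonempty ∧ x = s₂}
  R := F₂.R ∪ {p | ∃ T ∈ D, p = ((T ∩ F₂.A) ∪ {s₂}, s₂)}
  S := F₂.S ∪ {p | ∃ T ∈ D, p = (T ∩ F₂.A, s₂)}
  finite_A := F₂.finite_A.union ((Set.finite_singleton s₂).subset fun _ hx => hx.2)
  R_sub := by
    rintro p (hp | ⟨T, hT, rfl⟩)
    · exact ⟨(F₂.R_sub p hp).1.trans Set.subset_union_left, Or.inl (F₂.R_sub p hp).2⟩
    · refine ⟨?_, Or.inr ⟨⟨T, hT⟩, rfl⟩⟩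
      rintro x (hx | rfl)
      · exact Or.inl hx.2
      · exact Or.inr ⟨⟨T, hT⟩, rfl⟩
  S_sub := by
    rintro p (hp | ⟨T, hT, rfl⟩)
    · exact ⟨(F₂.S_sub p hp).1.trans Set.subset_union_left, Or.inl (F₂.S_sub p hp).2⟩
    · exact ⟨fun x hx => Or.inl hx.2, Or.inr ⟨⟨T, hT⟩, rfl⟩⟩

/-- Componentwise union of two frameworks. -/
def union (F G : BSAF α) : BSAF α where
  A := F.A ∪ G.A
  R := F.R ∪ G.R
  S := F.S ∪ G.S
  finite_A := F.finite_A.union G.finite_A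
  R_sub := by
    rintro p (hp | hp)
    · exact ⟨(F.R_sub p hp).1.trans Set.subset_union_left, Or.inl (F.R_sub p hp).2⟩
    · exact ⟨(G.R_sub p hp).1.trans Set.subset_union_right, Or.inr (G.R_sub p hp).2⟩
  S_sub := by
    rintro p (hp | hp)
    · exact ⟨(F.S_sub p hp).1.trans Set.subset_union_left, Or.inl (F.S_sub p hp).2⟩
    · exact ⟨(G.S_sub p hp).1.trans Set.subset_union_right, Or.inr (G.S_sub p hp).2⟩

/-- The `(E₁, S₃)`-reduct (S-reduct) of `F₂` for the support splitting `(F₁, F₂, S₃)`. -/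
def sReduct (F₁ F₂ : BSAF α) (S₃ : Set (Link α)) (E₁ : Set α) (s₁ s₂ : α) : BSAF α :=
  union (typeOne F₂ (closureDefeated F₁ F₂ S₃ E₁) s₁)
    (typeTwo F₂ (incompatible F₁ S₃ E₁ \ closureDefeated F₁ F₂ S₃ E₁) s₂)

/-- The closure of a set of arguments consists of arguments. -/
theorem cl_subset (F : BSAF α) {E : Set α} (hE : E ⊆ F.A) : cl F.S E ⊆ F.A := by
  have key : ∀ i : ℕ, (supp F.S)^[i] E ⊆ F.A := by
    intro i
    induction i with
    | zero => exact hE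
    | succ k ih =>
      rw [Function.iterate_succ_apply']
      rintro x (hx | ⟨T, hT, -⟩)
      · exact ih hx
      · exact (F.S_sub _ hT).2
  exact Set.iUnion₂_subset fun i _ => key i

section Combined

variable {F F₁ F₂ : BSAF α} {R₃ S₃ : Set (Link α)}

/-- The framework `F̂₂ = (A₂, R̂₂, S₂)`, where `R̂₂` consists of the closed attacks
of `F₂` whose tail does not meet `A₁`. -/
def hatF₂ (h : IsSplitting F F₁ F₂ R₃ S₃) : BSAF α where
  A := F₂.A
  R := {p | p ∈ closeLinks F.S F₂.R ∧ p.1 ∩ F₁.A = ∅}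
  S := F₂.S
  finite_A := F₂.finite_A
  R_sub := by
    rintro p ⟨⟨T, a, hT, rfl⟩, hp⟩
    refine ⟨fun x hx => ?_, (F₂.R_sub _ hT).2⟩
    have hxA : x ∈ F.A := F.cl_subset ((F₂.R_sub _ hT).1.trans h.sub₂.1) hx
    rw [h.A_eq] at hxA
    rcases hxA with h1 | h2
    · exact absurd (show x ∈ cl F.S T ∩ F₁.A from ⟨hx, h1⟩) (by simp only [hp]; exact id)
    · exact h2
  S_sub := F₂.S_sub

/-- The set `R̂₃` of closed attacks from `R₃` and `R₂` whose tail meets `A₁`. -/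
def hatR₃ (_ : IsSplitting F F₁ F₂ R₃ S₃) : Set (Link α) :=
  {p | p ∈ closeLinks F.S R₃ ∪ closeLinks F.S F₂.R ∧ (p.1 ∩ F₁.A).Nonempty}

theorem hatR₃_head (h : IsSplitting F F₁ F₂ R₃ S₃) : ∀ p ∈ hatR₃ h, p.2 ∈ F₂.A := by
  rintro p ⟨⟨T, a, hT, rfl⟩ | ⟨T, a, hT, rfl⟩, -⟩
  · exact (h.R₃_sub hT).2.2.2
  · exact (F₂.R_sub _ hT).2

/-- `F₂⋆`: the modification of the R-reduct of the attack splitting `(F₁, F̂₂, R̂₃)`. -/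
def starF₂ (h : IsSplitting F F₁ F₂ R₃ S₃) (E₁ : Set α) (s₀ : α) : BSAF α :=
  modification (rReduct F₁ (hatF₂ h) (hatR₃ h) (hatR₃_head h) E₁)
    (undecided F₁ (hatF₂ h) (hatR₃ h) E₁) (fun p hp => hatR₃_head h p hp.1) s₀

/-- `F₂⊛`: the S-reduct of `F₂⋆` for the support splitting `(F₁, F₂⋆, S₃)`. -/
def circledastF₂ (h : IsSplitting F F₁ F₂ R₃ S₃) (E₁ : Set α) (s₀ s₁ s₂ : α) : BSAF α :=
  sReduct F₁ (starF₂ h E₁ s₀) S₃ E₁ s₁ s₂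

end Combined

end BSAF

/-!
The links of `F` between the two parts point in opposite directions: shared attacks go from `A₁`
to `A₂`, shared supports from `A₂` to `A₁`. The theorem rests on a correspondence between a closed
conflict-free set `E` of `F` and the pair consisting of `E₁ = E ∩ A₁` and a set `E₂` of arguments
of `F₂⊛` with `E₂ ∩ A₂ = E ∩ A₂`, where among the fresh arguments `E₂` may contain only `*₂`
(`BSAF.Corresponds`). Across the correspondence `E` attacks an argument of `A₁` exactly if `E₁`
does in `F₁`, it attacks an argument of `A₂` exactly if `E₂` does in `F₂⊛`, and the same holds for
defence (`Corresponds.defends_fst`, `Corresponds.defends_snd`). All three semantics are phrased in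
these terms.

For attacks on `A₁` only `F₁` matters; since no support of `F₂` has an empty tail and the tail of
every shared support meets `A₂`, a set closed in `F₁` is closed in `F` as well. For attacks on
`A₂`, closed attackers may be shrunk to closures of tails of attacks, which is why the closed
attacks `R̂₂` and `R̂₃` suffice. Such a closed tail `T` gives rise to the attacker `T ∩ A₂` or
`(T ∩ A₂) ∪ {*₀}` in `F₂⊛`, depending on whether `T ∩ A₁ ⊆ E₁`. Its closure in `F₂⊛` adds at
most `*₁` and `*₂`. Now `*₀` is attacked by itself only, so `E₂` never attacks it; `E₂` cannot
attack `*₂` because it contains no `T ∩ A₂` for an incompatible tail `T`; and `*₁` occurs only if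
`T` contains the closure of a closure-defeated tail, in which case `E` attacks `T`.

In the converse direction it remains to decide whether `*₂` is added to `E ∩ A₂`: it is added
exactly if it is defended.
-/

namespace BSAF

variable {α : Type*}

/-! ### Closure and closed sets -/

theorem isClosedIn_iff {F : BSAF α} {E : Set α} :
    F.IsClosedIn E ↔ ∀ T a, (T, a) ∈ F.S → T ⊆ E → a ∈ E := by
  constructor
  · intro hE T a hT hTE
    rw [← show cl F.S E = E from hE]
    exact Set.mem_iUnion₂.2 ⟨1, Set.mem_Ici.2 le_rfl, Or.inr ⟨T, hT, hTE⟩⟩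
  · intro hE
    have hs : supp F.S E = E := by
      refine Set.union_eq_self_of_subset_right ?_
      rintro a ⟨T, hT, hTE⟩
      exact hE T a hT hTE
    have hi : ∀ i, (supp F.S)^[i] E = E := fun i => Function.iterate_fixed hs i
    refine Set.Subset.antisymm (Set.iUnion₂_subset fun i _ => (hi i).subset) fun x hx => ?_
    exact Set.mem_iUnion₂.2 ⟨1, Set.mem_Ici.2 le_rfl, by rw [hi]; exact hx⟩

theorem subset_cl (S : Set (Link α)) (E : Set α) : E ⊆ cl S E := fun _ hx =>
  Set.mem_iUnion₂.2 ⟨1, Set.mem_Ici.2 le_rfl, Or.inl hx⟩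

theorem cl_subset_of_isClosedIn {F : BSAF α} {E X : Set α} (hX : F.IsClosedIn X) (hE : E ⊆ X) :
    cl F.S E ⊆ X := by
  refine Set.iUnion₂_subset fun i hi => ?_
  clear hi
  induction i with
  | zero => exact hE
  | succ k ih =>
    rw [Function.iterate_succ_apply']
    rintro a (ha | ⟨T, hT, hTE⟩)
    · exact ih ha
    · exact isClosedIn_iff.1 hX T a hT (hTE.trans ih)

/-- Tails of supports are finite, so a tail contained in the closure is contained in one of its
finite stages. -/
theorem isClosedIn_cl (F : BSAF α) (E : Set α) : F.IsClosedIn (cl F.S E) := by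
  refine isClosedIn_iff.2 fun T a hT hTE => ?_
  have hfin : T.Finite := F.finite_A.subset (F.S_sub _ hT).1
  have hmono : Monotone fun i => (supp F.S)^[i] E := by
    refine monotone_nat_of_le_succ fun i => ?_
    rw [Function.iterate_succ_apply']
    exact Set.subset_union_left
  have hsub : T ⊆ ⋃ i, (supp F.S)^[i] E := hTE.trans (Set.iUnion₂_subset_iUnion _ _)
  obtain ⟨n, hn⟩ := hmono.directed_le.exists_mem_subset_of_finset_subset_biUnion
    (s := hfin.toFinset) (by simpa using hsub)
  refine Set.mem_iUnion₂.2 ⟨n + 1, Set.mem_Ici.2 (by omega), ?_⟩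
  rw [Function.iterate_succ_apply']
  exact Or.inr ⟨T, hT, by simpa using hn⟩

theorem plus_mono {R : Set (Link α)} {E E' : Set α} (hE : E ⊆ E') : plus R E ⊆ plus R E' := by
  rintro a ⟨T, hT, hTE⟩
  exact ⟨T, hT, hTE.trans hE⟩

section Splitting

variable {F F₁ F₂ : BSAF α} {R₃ S₃ : Set (Link α)}

namespace IsSplitting

/-! ### Attacks and closed sets in a split framework -/

theorem notMem_snd (h : IsSplitting F F₁ F₂ R₃ S₃) {a : α} (ha : a ∈ F₁.A) : a ∉ F₂.A :=
  fun h2 => (h.disj.subset ⟨ha, h2⟩).elim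

theorem mem_or (h : IsSplitting F F₁ F₂ R₃ S₃) {a : α} (ha : a ∈ F.A) : a ∈ F₁.A ∨ a ∈ F₂.A := by
  rwa [h.A_eq] at ha

/-- Only attacks of `F₁` have their head in `A₁`. -/
theorem mem_plus_fst (h : IsSplitting F F₁ F₂ R₃ S₃) {E : Set α} {a : α} (ha : a ∈ F₁.A) :
    a ∈ plus F.R E ↔ a ∈ plus F₁.R (E ∩ F₁.A) := by
  constructor
  · rintro ⟨T, hT, hTE⟩
    rw [h.R_eq] at hT
    rcases hT with (hT | hT) | hT
    · exact ⟨T, hT, Set.subset_inter hTE (F₁.R_sub _ hT).1⟩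
    · exact (h.notMem_snd ha (F₂.R_sub _ hT).2).elim
    · exact (h.notMem_snd ha (h.R₃_sub hT).2.2.2).elim
  · rintro ⟨T, hT, hTE⟩
    exact ⟨T, h.sub₁.2.1 hT, hTE.trans Set.inter_subset_left⟩

theorem isClosedIn_fst (h : IsSplitting F F₁ F₂ R₃ S₃) {X : Set α} (hX : F.IsClosedIn X) :
    F₁.IsClosedIn (X ∩ F₁.A) :=
  isClosedIn_iff.2 fun T a hT hTX =>
    ⟨isClosedIn_iff.1 hX T a (h.sub₁.2.2 hT) (hTX.trans Set.inter_subset_left), (F₁.S_sub _ hT).2⟩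

theorem isClosedIn_of_fst (h : IsSplitting F F₁ F₂ R₃ S₃) (hS₂ : ∀ a, (∅, a) ∉ F₂.S)
    {X : Set α} (hXA : X ⊆ F₁.A) (hX : F₁.IsClosedIn X) : F.IsClosedIn X := by
  refine isClosedIn_iff.2 fun T a hT hTX => ?_
  rw [h.S_eq] at hT
  rcases hT with (hT | hT) | hT
  · exact isClosedIn_iff.1 hX T a hT hTX
  · have : T = ∅ := Set.eq_empty_of_forall_notMem fun x hx =>
      h.notMem_snd (hXA (hTX hx)) ((F₂.S_sub _ hT).1 hx)
    exact (hS₂ a (this ▸ hT)).elim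
  · obtain ⟨x, hx, hx2⟩ := (h.S₃_sub hT).2.1
    exact (h.notMem_snd (hXA (hTX hx)) hx2).elim

theorem mem_hatF₂ (h : IsSplitting F F₁ F₂ R₃ S₃) {T : Set α} {a : α} (hT : (T, a) ∈ (hatF₂ h).R) :
    T ⊆ F₂.A ∧ a ∈ F₂.A ∧ F.IsClosedIn T ∧ a ∈ plus F.R T := by
  refine ⟨((hatF₂ h).R_sub _ hT).1, ((hatF₂ h).R_sub _ hT).2, ?_⟩
  obtain ⟨⟨T', a', hT', heq⟩, -⟩ := hT
  obtain ⟨rfl, rfl⟩ := Prod.mk.inj heq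
  exact ⟨isClosedIn_cl F T', T', h.sub₂.2.1 hT', subset_cl _ _⟩

theorem mem_hatR₃ (h : IsSplitting F F₁ F₂ R₃ S₃) {T : Set α} {a : α} (hT : (T, a) ∈ hatR₃ h) :
    T ⊆ F.A ∧ a ∈ F₂.A ∧ F.IsClosedIn T ∧ a ∈ plus F.R T := by
  have ha := hatR₃_head h _ hT
  have key : ∃ T', (T', a) ∈ F.R ∧ T = cl F.S T' := by
    rcases hT.1 with ⟨T', a', hT', heq⟩ | ⟨T', a', hT', heq⟩ <;>
      obtain ⟨rfl, rfl⟩ := Prod.mk.inj heq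
    · exact ⟨T', (h.R₃_sub hT').1, rfl⟩
    · exact ⟨T', h.sub₂.2.1 hT', rfl⟩
  obtain ⟨T', hT', rfl⟩ := key
  exact ⟨F.cl_subset (F.R_sub _ hT').1, ha, isClosedIn_cl F T', T', hT', subset_cl _ _⟩

/-- A closed set attacks an argument of `A₂` only by closed attacks. -/
theorem exists_closed_attack (h : IsSplitting F F₁ F₂ R₃ S₃) {X : Set α} (hX : F.IsClosedIn X)
    {a : α} (ha : a ∈ F₂.A) (haX : a ∈ plus F.R X) :
    ∃ T ⊆ X, (T, a) ∈ (hatF₂ h).R ∨ (T, a) ∈ hatR₃ h := by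
  obtain ⟨T, hT, hTX⟩ := haX
  refine ⟨cl F.S T, cl_subset_of_isClosedIn hX hTX, ?_⟩
  rw [h.R_eq] at hT
  rcases hT with (hT | hT) | hT
  · exact (h.notMem_snd (F₁.R_sub _ hT).2 ha).elim
  · rcases Set.eq_empty_or_nonempty (cl F.S T ∩ F₁.A) with h0 | h0
    · exact Or.inl ⟨⟨T, a, hT, rfl⟩, h0⟩
    · exact Or.inr ⟨Or.inr ⟨T, a, hT, rfl⟩, h0⟩
  · obtain ⟨x, hx, hx1⟩ := (h.R₃_sub hT).2.1
    exact Or.inr ⟨Or.inl ⟨T, a, hT, rfl⟩, ⟨x, subset_cl _ _ hx, hx1⟩⟩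

theorem tail_of_incompatible (h : IsSplitting F F₁ F₂ R₃ S₃) {E₁ T : Set α}
    (hT : T ∈ incompatible F₁ S₃ E₁) : T ⊆ F.A ∧ (T ∩ F₂.A).Nonempty := by
  obtain ⟨b, -, hb, -⟩ := hT
  exact ⟨(h.S₃_sub hb).2.2.1, (h.S₃_sub hb).2.1⟩

/-! ### The components of the modified second framework -/

theorem mem_circledastF₂_A (h : IsSplitting F F₁ F₂ R₃ S₃) (E₁ : Set α) (s₀ s₁ s₂ x : α) :
    x ∈ (circledastF₂ h E₁ s₀ s₁ s₂).A ↔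
      x ∈ F₂.A ∨ ((undecided F₁ (hatF₂ h) (hatR₃ h) E₁).Nonempty ∧ x = s₀) ∨
      ((closureDefeated F₁ (starF₂ h E₁ s₀) S₃ E₁).Nonempty ∧ x = s₁) ∨
      ((incompatible F₁ S₃ E₁ \ closureDefeated F₁ (starF₂ h E₁ s₀) S₃ E₁).Nonempty ∧ x = s₂) := by
  simp only [circledastF₂, sReduct, union, typeOne, typeTwo, Set.mem_union, Set.mem_ofPred_eq]
  simp only [starF₂, modification, rReduct, hatF₂, Set.mem_union, Set.mem_ofPred_eq]
  tauto

theorem tail_inter_starF₂ (h : IsSplitting F F₁ F₂ R₃ S₃) (E₁ : Set α) {s₀ : α} (hs₀ : s₀ ∉ F.A)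
    {T : Set α} (hT : T ⊆ F.A) : T ∩ (starF₂ h E₁ s₀).A = T ∩ F₂.A := by
  ext x
  constructor
  · rintro ⟨hx, hx2 | ⟨-, rfl⟩⟩
    · exact ⟨hx, hx2⟩
    · exact (hs₀ (hT hx)).elim
  · rintro ⟨hx, hx2⟩
    exact ⟨hx, Or.inl hx2⟩

theorem mem_circledastF₂_S (h : IsSplitting F F₁ F₂ R₃ S₃) (E₁ : Set α) {s₀ : α} (s₁ s₂ : α)
    (hs₀ : s₀ ∉ F.A) (T : Set α) (a : α) :
    (T, a) ∈ (circledastF₂ h E₁ s₀ s₁ s₂).S ↔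
      (T, a) ∈ F₂.S ∨
      (∃ T' ∈ closureDefeated F₁ (starF₂ h E₁ s₀) S₃ E₁, T = T' ∩ F₂.A ∧ a = s₁) ∨
      (∃ T' ∈ incompatible F₁ S₃ E₁ \ closureDefeated F₁ (starF₂ h E₁ s₀) S₃ E₁,
        T = T' ∩ F₂.A ∧ a = s₂) := by
  have e : ∀ T' ∈ incompatible F₁ S₃ E₁, T' ∩ (starF₂ h E₁ s₀).A = T' ∩ F₂.A := fun T' hT' =>
    h.tail_inter_starF₂ E₁ hs₀ (h.tail_of_incompatible hT').1
  constructor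
  · rintro ((hT | ⟨T', hT', heq⟩) | (hT | ⟨T', hT', heq⟩))
    · exact Or.inl hT
    · obtain ⟨rfl, rfl⟩ := Prod.mk.inj heq
      exact Or.inr (Or.inl ⟨T', hT', e T' hT'.1, rfl⟩)
    · exact Or.inl hT
    · obtain ⟨rfl, rfl⟩ := Prod.mk.inj heq
      exact Or.inr (Or.inr ⟨T', hT', e T' hT'.1, rfl⟩)
  · rintro (hT | ⟨T', hT', rfl, rfl⟩ | ⟨T', hT', rfl, rfl⟩)
    · exact Or.inl (Or.inl hT)
    · exact Or.inl (Or.inr ⟨T', hT', by rw [e T' hT'.1]⟩)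
    · exact Or.inr (Or.inr ⟨T', hT', by rw [e T' hT'.1]⟩)

theorem mem_circledastF₂_R (h : IsSplitting F F₁ F₂ R₃ S₃) (E₁ : Set α) {s₀ : α} (s₁ s₂ : α)
    (hs₀ : s₀ ∉ F.A) (T : Set α) (a : α) :
    (T, a) ∈ (circledastF₂ h E₁ s₀ s₁ s₂).R ↔
      (T, a) ∈ (starF₂ h E₁ s₀).R ∨
      ((closureDefeated F₁ (starF₂ h E₁ s₀) S₃ E₁).Nonempty ∧ T = ∅ ∧ a = s₁) ∨
      (∃ T' ∈ incompatible F₁ S₃ E₁ \ closureDefeated F₁ (starF₂ h E₁ s₀) S₃ E₁,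
        T = T' ∩ F₂.A ∪ {s₂} ∧ a = s₂) := by
  have e : ∀ T' ∈ incompatible F₁ S₃ E₁, T' ∩ (starF₂ h E₁ s₀).A = T' ∩ F₂.A := fun T' hT' =>
    h.tail_inter_starF₂ E₁ hs₀ (h.tail_of_incompatible hT').1
  constructor
  · rintro ((hT | ⟨hne, heq⟩) | (hT | ⟨T', hT', heq⟩))
    · exact Or.inl hT
    · obtain ⟨rfl, rfl⟩ := Prod.mk.inj heq
      exact Or.inr (Or.inl ⟨hne, rfl, rfl⟩)
    · exact Or.inl hT
    · obtain ⟨rfl, rfl⟩ := Prod.mk.inj heq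
      exact Or.inr (Or.inr ⟨T', hT', by rw [e T' hT'.1], rfl⟩)
  · rintro (hT | ⟨hne, rfl, rfl⟩ | ⟨T', hT', rfl, rfl⟩)
    · exact Or.inl (Or.inl hT)
    · exact Or.inl (Or.inr ⟨hne, rfl⟩)
    · exact Or.inr (Or.inr ⟨T', hT', by rw [e T' hT'.1]⟩)

theorem mem_starF₂_R (h : IsSplitting F F₁ F₂ R₃ S₃) (E₁ : Set α) (s₀ : α) (T : Set α) (a : α) :
    (T, a) ∈ (starF₂ h E₁ s₀).R ↔
      (T, a) ∈ (hatF₂ h).R ∨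
      (∃ T', (T', a) ∈ hatR₃ h ∧ T' ∩ plus (F₁.R ∪ hatR₃ h) E₁ = ∅ ∧ T' ∩ F₁.A ⊆ E₁ ∧
        T = T' ∩ F₂.A) ∨
      ((undecided F₁ (hatF₂ h) (hatR₃ h) E₁).Nonempty ∧ T = {s₀} ∧ a = s₀) ∨
      (∃ T', (T', a) ∈ undecided F₁ (hatF₂ h) (hatR₃ h) E₁ ∧ T = T' ∩ F₂.A ∪ {s₀}) := by
  constructor
  · rintro (((hT | ⟨T', a', hT', h1, h2, heq⟩) | ⟨hne, heq⟩) | ⟨T', a', hT', heq⟩)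
    · exact Or.inl hT
    · obtain ⟨rfl, rfl⟩ := Prod.mk.inj heq
      exact Or.inr (Or.inl ⟨T', hT', h1, h2, rfl⟩)
    · obtain ⟨rfl, rfl⟩ := Prod.mk.inj heq
      exact Or.inr (Or.inr (Or.inl ⟨hne, rfl, rfl⟩))
    · obtain ⟨rfl, rfl⟩ := Prod.mk.inj heq
      exact Or.inr (Or.inr (Or.inr ⟨T', hT', rfl⟩))
  · rintro (hT | ⟨T', hT', h1, h2, rfl⟩ | ⟨hne, rfl, rfl⟩ | ⟨T', hT', rfl⟩)
    · exact Or.inl (Or.inl (Or.inl hT))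
    · exact Or.inl (Or.inl (Or.inr ⟨T', a, hT', h1, h2, rfl⟩))
    · exact Or.inl (Or.inr ⟨hne, rfl⟩)
    · exact Or.inr ⟨T', a, hT', rfl⟩

theorem starF₂_R_subset (h : IsSplitting F F₁ F₂ R₃ S₃) (E₁ : Set α) (s₀ s₁ s₂ : α) :
    (starF₂ h E₁ s₀).R ⊆ (circledastF₂ h E₁ s₀ s₁ s₂).R := fun _ hp => Or.inl (Or.inl hp)

/-- The tails of all supports of `F₂⊛` are nonempty subsets of `A₂`. -/
theorem circledastF₂_S_tail (h : IsSplitting F F₁ F₂ R₃ S₃) (hS₂ : ∀ a, (∅, a) ∉ F₂.S) {E₁ : Set α}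
    {s₀ s₁ s₂ : α} (hs₀ : s₀ ∉ F.A) {T : Set α} {a : α}
    (hT : (T, a) ∈ (circledastF₂ h E₁ s₀ s₁ s₂).S) : T ⊆ F₂.A ∧ T.Nonempty := by
  rcases (h.mem_circledastF₂_S E₁ s₁ s₂ hs₀ T a).1 hT with
    hT | ⟨T', hT', rfl, -⟩ | ⟨T', hT', rfl, -⟩
  · refine ⟨(F₂.S_sub _ hT).1, Set.nonempty_iff_ne_empty.2 ?_⟩
    rintro rfl
    exact hS₂ a hT
  · exact ⟨Set.inter_subset_right, (h.tail_of_incompatible hT'.1).2⟩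
  · exact ⟨Set.inter_subset_right, (h.tail_of_incompatible hT'.1).2⟩

/-- One support step closes a set of `F₂⊛` that is closed under the supports of `F₂`, since the
fresh arguments do not occur in tails of supports. -/
theorem isClosedIn_supp (h : IsSplitting F F₁ F₂ R₃ S₃) (hS₂ : ∀ a, (∅, a) ∉ F₂.S) {E₁ : Set α}
    {s₀ s₁ s₂ : α} (hs₀ : s₀ ∉ F.A) (hs₁ : s₁ ∉ F.A) (hs₂ : s₂ ∉ F.A) {X : Set α}
    (hX : ∀ T a, (T, a) ∈ F₂.S → T ⊆ X → a ∈ X) :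
    (circledastF₂ h E₁ s₀ s₁ s₂).IsClosedIn (supp (circledastF₂ h E₁ s₀ s₁ s₂).S X) := by
  refine isClosedIn_iff.2 fun T a hT hTX => Or.inr ⟨T, hT, fun x hx => ?_⟩
  have hx2 : x ∈ F₂.A := (h.circledastF₂_S_tail hS₂ hs₀ hT).1 hx
  rcases hTX hx with hxX | ⟨T', hT', hT'X⟩
  · exact hxX
  · rcases (h.mem_circledastF₂_S E₁ s₁ s₂ hs₀ T' x).1 hT' with
      hT' | ⟨-, -, -, rfl⟩ | ⟨-, -, -, rfl⟩
    · exact hX T' x hT' hT'X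
    · exact (hs₁ (h.sub₂.1 hx2)).elim
    · exact (hs₂ (h.sub₂.1 hx2)).elim

end IsSplitting

/-! ### Corresponding sets -/

/-- `E` is a closed conflict-free set of `F` that corresponds to the pair `(E₁, E₂)`: `E₁` is the
trace of `E` on `A₁`, and `E₂` agrees with `E` on `A₂` and may in addition contain the fresh
argument `s₂` (whether or not `s₂` is an argument of `F₂⊛`). -/
structure Corresponds (F F₁ F₂ : BSAF α) (s₂ : α) (E E₁ E₂ : Set α) : Prop where
  cf : E ∈ F.cf
  closed : F.IsClosedIn E
  fst : E₁ = E ∩ F₁.A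
  snd : E ∩ F₂.A = E₂ ∩ F₂.A
  sub : ∀ x ∈ E₂, x ∈ F₂.A ∨ x = s₂

namespace Corresponds

variable {E E₁ E₂ : Set α} {s₀ s₁ s₂ : α}

theorem fst_subset (c : Corresponds F F₁ F₂ s₂ E E₁ E₂) : E₁ ⊆ E :=
  c.fst.subset.trans Set.inter_subset_left

theorem mem_snd (c : Corresponds F F₁ F₂ s₂ E E₁ E₂) {x : α} (hx : x ∈ F₂.A) :
    x ∈ E₂ ↔ x ∈ E :=
  ⟨fun h2 => (c.snd.symm.subset ⟨h2, hx⟩).1, fun h2 => (c.snd.subset ⟨h2, hx⟩).1⟩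

theorem not_mem_plus (c : Corresponds F F₁ F₂ s₂ E E₁ E₂) {x : α} (hx : x ∈ E) : x ∉ plus F.R E :=
  fun hp => c.cf.2 ⟨x, hp, hx⟩

/-- A tail of an attack or support is contained in `E` as soon as its parts are contained in `E₁`
and in `E₂`. -/
theorem tail_subset (h : IsSplitting F F₁ F₂ R₃ S₃) (c : Corresponds F F₁ F₂ s₂ E E₁ E₂)
    {T : Set α} (hT : T ⊆ F.A) (h1 : T ∩ F₁.A ⊆ E₁) (h2 : T ∩ F₂.A ⊆ E₂) : T ⊆ E := by
  intro x hx
  rcases h.mem_or (hT hx) with hx1 | hx2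
  · exact c.fst_subset (h1 ⟨hx, hx1⟩)
  · exact (c.mem_snd hx2).1 (h2 ⟨hx, hx2⟩)

theorem not_subset_of_incompatible (h : IsSplitting F F₁ F₂ R₃ S₃)
    (c : Corresponds F F₁ F₂ s₂ E E₁ E₂) {T : Set α} (hT : T ∈ incompatible F₁ S₃ E₁) :
    ¬ T ∩ F₂.A ⊆ E₂ := by
  intro h2
  have hTA := (h.tail_of_incompatible hT).1
  obtain ⟨b, hb, hTb, h1, hbE⟩ := hT
  refine hbE (c.fst.symm.subset ⟨?_, hb⟩)
  exact isClosedIn_iff.1 c.closed T b (h.S₃_sub hTb).1 (c.tail_subset h hTA h1 h2)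

theorem plus_fst_subset (h : IsSplitting F F₁ F₂ R₃ S₃) (c : Corresponds F F₁ F₂ s₂ E E₁ E₂) :
    plus (F₁.R ∪ (hatF₂ h).R ∪ hatR₃ h) E₁ ⊆ plus F.R E := by
  rintro x ⟨T, (hT | hT) | hT, hTE⟩
  · exact ⟨T, h.sub₁.2.1 hT, hTE.trans c.fst_subset⟩
  · exact plus_mono (hTE.trans c.fst_subset) (h.mem_hatF₂ hT).2.2.2
  · exact plus_mono (hTE.trans c.fst_subset) (h.mem_hatR₃ hT).2.2.2

/-- An attack of `F₂⊛` by `E₂` is an attack of `F` by `E`, except that `s₁` is attacked by the empty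
set. -/
theorem mem_plus_of_circledast (h : IsSplitting F F₁ F₂ R₃ S₃)
    (c : Corresponds F F₁ F₂ s₂ E E₁ E₂) (hs₀ : s₀ ∉ F.A) (h₀₂ : s₀ ≠ s₂) {a : α}
    (ha : a ∈ plus (circledastF₂ h E₁ s₀ s₁ s₂).R E₂) :
    (a ∈ F₂.A ∧ a ∈ plus F.R E) ∨
      (a = s₁ ∧ (closureDefeated F₁ (starF₂ h E₁ s₀) S₃ E₁).Nonempty) := by
  have h0 : s₀ ∉ E₂ := fun h0 => (c.sub _ h0).elim (fun h2 => hs₀ (h.sub₂.1 h2)) h₀₂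
  obtain ⟨T, hT, hTE⟩ := ha
  rcases (h.mem_circledastF₂_R E₁ s₁ s₂ hs₀ T a).1 hT with
    hT | ⟨hne, -, rfl⟩ | ⟨T', hT', rfl, rfl⟩
  · rcases (h.mem_starF₂_R E₁ s₀ T a).1 hT with
      hT | ⟨T', hT', -, h1, rfl⟩ | ⟨-, rfl, rfl⟩ | ⟨T', hT', rfl⟩
    · obtain ⟨hT2, ha, -, hp⟩ := h.mem_hatF₂ hT
      exact Or.inl ⟨ha, plus_mono (fun x hx => (c.mem_snd (hT2 hx)).1 (hTE hx)) hp⟩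
    · obtain ⟨hTA, ha, -, hp⟩ := h.mem_hatR₃ hT'
      exact Or.inl ⟨ha, plus_mono (c.tail_subset h hTA h1 hTE) hp⟩
    · exact (h0 (hTE rfl)).elim
    · exact (h0 (hTE (Or.inr rfl))).elim
  · exact Or.inr ⟨rfl, hne⟩
  · exact (c.not_subset_of_incompatible h hT'.1 (Set.subset_union_left.trans hTE)).elim

theorem mem_plus_circledast (h : IsSplitting F F₁ F₂ R₃ S₃)
    (c : Corresponds F F₁ F₂ s₂ E E₁ E₂) {a : α} (ha : a ∈ F₂.A) (hp : a ∈ plus F.R E) :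
    a ∈ plus (circledastF₂ h E₁ s₀ s₁ s₂).R E₂ := by
  obtain ⟨T, hTE, hT⟩ := h.exists_closed_attack c.closed ha hp
  rcases hT with hT | hT
  · refine ⟨T, h.starF₂_R_subset E₁ s₀ s₁ s₂ ((h.mem_starF₂_R E₁ s₀ T a).2 (Or.inl hT)), ?_⟩
    exact fun x hx => (c.mem_snd ((h.mem_hatF₂ hT).1 hx)).2 (hTE hx)
  · refine ⟨T ∩ F₂.A, h.starF₂_R_subset E₁ s₀ s₁ s₂ ((h.mem_starF₂_R E₁ s₀ _ a).2
      (Or.inr (Or.inl ⟨T, hT, ?_, ?_, rfl⟩))), fun x hx => (c.mem_snd hx.2).2 (hTE hx.1)⟩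
    · refine Set.eq_empty_of_forall_notMem fun x hx => c.not_mem_plus (hTE hx.1) ?_
      refine c.plus_fst_subset h ?_
      obtain ⟨T', hT' | hT', hT'E⟩ := hx.2
      · exact ⟨T', Or.inl (Or.inl hT'), hT'E⟩
      · exact ⟨T', Or.inr hT', hT'E⟩
    · rw [c.fst]
      exact Set.inter_subset_inter_left _ hTE

/-- Arguments attacked by `E₁` in the framework in which closure-defeat is evaluated. -/
theorem plus_fst_star_subset (h : IsSplitting F F₁ F₂ R₃ S₃) (c : Corresponds F F₁ F₂ s₂ E E₁ E₂)
    (hs₀ : s₀ ∉ F.A) : plus (F₁.R ∪ (starF₂ h E₁ s₀).R) E₁ ⊆ plus F.R E := by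
  have h0 : s₀ ∉ E₁ := fun h0 => hs₀ (c.cf.1 (c.fst_subset h0))
  rintro x ⟨T, hT | hT, hTE⟩
  · exact ⟨T, h.sub₁.2.1 hT, hTE.trans c.fst_subset⟩
  · rcases (h.mem_starF₂_R E₁ s₀ T x).1 hT with
      hT | ⟨T', hT', -, h1, rfl⟩ | ⟨-, rfl, rfl⟩ | ⟨T', hT', rfl⟩
    · exact plus_mono (hTE.trans c.fst_subset) (h.mem_hatF₂ hT).2.2.2
    · obtain ⟨hTA, -, -, hp⟩ := h.mem_hatR₃ hT'
      refine plus_mono (fun y hy => ?_) hp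
      rcases h.mem_or (hTA hy) with hy1 | hy2
      · exact c.fst_subset (h1 ⟨hy, hy1⟩)
      · exact c.fst_subset (hTE ⟨hy, hy2⟩)
    · exact (h0 (hTE rfl)).elim
    · exact (h0 (hTE (Or.inr rfl))).elim

/-! ### Defence -/

theorem defends_fst (h : IsSplitting F F₁ F₂ R₃ S₃) (hS₂ : ∀ a, (∅, a) ∉ F₂.S)
    (hE : E₁ = E ∩ F₁.A) {a : α} (ha : a ∈ F₁.A) : F.Defends E a ↔ F₁.Defends E₁ a := by
  subst hE
  constructor
  · intro hd X hXA hX haX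
    have haX' : a ∈ plus F.R X := by
      rwa [h.mem_plus_fst ha, Set.inter_eq_self_of_subset_left hXA]
    obtain ⟨x, hx, hxX⟩ := hd X (hXA.trans h.sub₁.1) (h.isClosedIn_of_fst hS₂ hXA hX) haX'
    exact ⟨x, (h.mem_plus_fst (hXA hxX)).1 hx, hxX⟩
  · intro hd X hXA hX haX
    obtain ⟨x, hx, hxX⟩ := hd (X ∩ F₁.A) Set.inter_subset_right (h.isClosedIn_fst hX)
      ((h.mem_plus_fst ha).1 haX)
    exact ⟨x, (h.mem_plus_fst hxX.2).2 hx, hxX.1⟩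

/-- A closed tail `T` of `F` is attacked by `E` as soon as `E₂` attacks every closed set of `F₂⊛`
around its trace `X` in `F₂⊛`, where `X` may contain `s₀` in addition to `T ∩ A₂`. -/
theorem attacksSet_of_trace (h : IsSplitting F F₁ F₂ R₃ S₃) (hS₂ : ∀ a, (∅, a) ∉ F₂.S)
    (c : Corresponds F F₁ F₂ s₂ E E₁ E₂) (hs₀ : s₀ ∉ F.A) (hs₁ : s₁ ∉ F.A) (hs₂ : s₂ ∉ F.A)
    (h₀₁ : s₀ ≠ s₁) (h₀₂ : s₀ ≠ s₂) (h₁₂ : s₁ ≠ s₂) {T X : Set α} (hT : F.IsClosedIn T)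
    (hX : X ⊆ (circledastF₂ h E₁ s₀ s₁ s₂).A) (hXT : X ⊆ T ∩ F₂.A ∪ {s₀}) (hTX : T ∩ F₂.A ⊆ X)
    (hatt : ∀ Y ⊆ (circledastF₂ h E₁ s₀ s₁ s₂).A, (circledastF₂ h E₁ s₀ s₁ s₂).IsClosedIn Y →
      X ⊆ Y → AttacksSet (circledastF₂ h E₁ s₀ s₁ s₂).R E₂ Y) :
    AttacksSet F.R E T := by
  set G := circledastF₂ h E₁ s₀ s₁ s₂
  have hXT2 : ∀ x ∈ X, x ∈ F.A → x ∈ T ∩ F₂.A := fun x hx hxA =>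
    (hXT hx).elim id fun h0 => (hs₀ (h0 ▸ hxA)).elim
  have hcl : G.IsClosedIn (supp G.S X) := by
    refine h.isClosedIn_supp hS₂ hs₀ hs₁ hs₂ fun U b hU hUX => hTX ⟨?_, (F₂.S_sub _ hU).2⟩
    exact isClosedIn_iff.1 hT U b (h.sub₂.2.2 hU) fun y hy =>
      (hXT2 y (hUX hy) (h.sub₂.1 ((F₂.S_sub _ hU).1 hy))).1
  have hsub : supp G.S X ⊆ G.A := by
    rintro x (hx | ⟨U, hU, -⟩)
    · exact hX hx
    · exact (G.S_sub _ hU).2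
  obtain ⟨x, hx, hxX⟩ := hatt _ hsub hcl Set.subset_union_left
  rcases c.mem_plus_of_circledast h hs₀ h₀₂ hx with ⟨hx2, hp⟩ | ⟨rfl, -⟩
  · refine ⟨x, hp, ?_⟩
    rcases hxX with hxX | ⟨U, hU, hUX⟩
    · exact (hXT2 x hxX (h.sub₂.1 hx2)).1
    · rcases (h.mem_circledastF₂_S E₁ s₁ s₂ hs₀ U x).1 hU with
        hU | ⟨-, -, -, rfl⟩ | ⟨-, -, -, rfl⟩
      · exact isClosedIn_iff.1 hT U x (h.sub₂.2.2 hU) fun y hy =>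
          (hXT2 y (hUX hy) (h.sub₂.1 ((F₂.S_sub _ hU).1 hy))).1
      · exact (hs₁ (h.sub₂.1 hx2)).elim
      · exact (hs₂ (h.sub₂.1 hx2)).elim
  · -- Here `s₁` is supported by `X`, so `T` contains the closure of a closure-defeated tail.
    rcases hxX with hxX | ⟨U, hU, hUX⟩
    · rcases hXT hxX with h2 | h0
      · exact (hs₁ (h.sub₂.1 h2.2)).elim
      · exact (h₀₁ h0.symm).elim
    · rcases (h.mem_circledastF₂_S E₁ x s₂ hs₀ U x).1 hU with
        hU | ⟨T', hT', rfl, -⟩ | ⟨-, -, -, rfl⟩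
      · exact (hs₁ (h.sub₂.1 (F₂.S_sub _ hU).2)).elim
      · have hT'A := (h.tail_of_incompatible hT'.1).1
        have hT'T : T' ⊆ T := by
          intro y hy
          rcases h.mem_or (hT'A hy) with hy1 | hy2
          · exact (hT'.2.1.subset ⟨hy, hy1⟩).elim
          · exact (hXT2 y (hUX ⟨hy, hy2⟩) (hT'A hy)).1
        obtain ⟨y, hy, hyp⟩ := hT'.2.2
        refine ⟨y, c.plus_fst_star_subset h hs₀ hyp, ?_⟩
        have hS : F₁.S ∪ (starF₂ h E₁ s₀).S ∪ S₃ = F.S := h.S_eq.symm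
        rw [hS] at hy
        exact cl_subset_of_isClosedIn hT hT'T hy
      · exact (h₁₂ rfl).elim

theorem defends_snd (h : IsSplitting F F₁ F₂ R₃ S₃) (hS₂ : ∀ a, (∅, a) ∉ F₂.S)
    (c : Corresponds F F₁ F₂ s₂ E E₁ E₂) (hs₀ : s₀ ∉ F.A) (hs₁ : s₁ ∉ F.A) (hs₂ : s₂ ∉ F.A)
    (h₀₁ : s₀ ≠ s₁) (h₀₂ : s₀ ≠ s₂) (h₁₂ : s₁ ≠ s₂) {a : α} (ha : a ∈ F₂.A) :
    F.Defends E a ↔ (circledastF₂ h E₁ s₀ s₁ s₂).Defends E₂ a := by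
  have haA := h.sub₂.1 ha
  have hA2 : ∀ x ∈ F₂.A, x ∈ (circledastF₂ h E₁ s₀ s₁ s₂).A := fun x hx =>
    (h.mem_circledastF₂_A E₁ s₀ s₁ s₂ x).2 (Or.inl hx)
  constructor
  · intro hd Y hYA hY haY
    -- It suffices that `E` attacks a closed tail in `F` at an argument of `A₂`.
    have key : ∀ T, F.IsClosedIn T → T ⊆ F.A → a ∈ plus F.R T → T ∩ F₂.A ⊆ Y →
        (∀ x ∈ T ∩ F₁.A, x ∉ plus F₁.R E₁) →
        AttacksSet (circledastF₂ h E₁ s₀ s₁ s₂).R E₂ Y := by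
      intro T hT hTA haT hTY hT1
      obtain ⟨x, hx, hxT⟩ := hd T hTA hT haT
      rcases h.mem_or (hTA hxT) with hx1 | hx2
      · refine (hT1 x ⟨hxT, hx1⟩ ?_).elim
        rw [c.fst]
        exact (h.mem_plus_fst hx1).1 hx
      · exact ⟨x, c.mem_plus_circledast h hx2 hx, hTY ⟨hxT, hx2⟩⟩
    obtain ⟨T, hT, hTY⟩ := haY
    rcases (h.mem_circledastF₂_R E₁ s₁ s₂ hs₀ T a).1 hT with
      hT | ⟨-, -, rfl⟩ | ⟨-, -, -, rfl⟩
    · rcases (h.mem_starF₂_R E₁ s₀ T a).1 hT with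
        hT | ⟨T', hT', -, h1, rfl⟩ | ⟨-, -, rfl⟩ | ⟨T', hT', rfl⟩
      · obtain ⟨hT2, -, hTc, hp⟩ := h.mem_hatF₂ hT
        exact key T hTc (hT2.trans h.sub₂.1) hp (Set.inter_subset_left.trans hTY)
          fun x hx => (h.notMem_snd hx.2 (hT2 hx.1)).elim
      · obtain ⟨hTA, -, hTc, hp⟩ := h.mem_hatR₃ hT'
        refine key T' hTc hTA hp hTY fun x hx hxp => ?_
        refine c.not_mem_plus (c.fst_subset (h1 hx)) ((h.mem_plus_fst hx.2).2 ?_)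
        rwa [← c.fst]
      · exact (hs₀ haA).elim
      · obtain ⟨hTA, -, hTc, hp⟩ := h.mem_hatR₃ hT'.1
        refine key T' hTc hTA hp (Set.subset_union_left.trans hTY) fun x hx hxp => ?_
        obtain ⟨U, hU, hUE⟩ := hxp
        exact (hT'.2.1.subset ⟨hx.1, U, Or.inl (Or.inl hU), hUE⟩).elim
    · exact (hs₁ haA).elim
    · exact (hs₂ haA).elim
  · intro hd X hXA hX haX
    obtain ⟨T, hTX, hT⟩ := h.exists_closed_attack hX ha haX
    suffices hatt : AttacksSet F.R E T from
      hatt.mono (Set.inter_subset_inter_right _ hTX)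
    by_contra hcon
    rcases hT with hT | hT
    · obtain ⟨hT2, -, hTc, -⟩ := h.mem_hatF₂ hT
      refine hcon (c.attacksSet_of_trace h hS₂ hs₀ hs₁ hs₂ h₀₁ h₀₂ h₁₂ hTc (X := T)
        (fun x hx => hA2 x (hT2 hx)) (fun x hx => Or.inl ⟨hx, hT2 hx⟩) Set.inter_subset_left
        fun Y hYA hY hTY => hd Y hYA hY ?_)
      exact ⟨T, h.starF₂_R_subset E₁ s₀ s₁ s₂ ((h.mem_starF₂_R E₁ s₀ T a).2 (Or.inl hT)), hTY⟩
    · have hTc := (h.mem_hatR₃ hT).2.2.1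
      have hfree : T ∩ plus (F₁.R ∪ (hatF₂ h).R ∪ hatR₃ h) E₁ = ∅ :=
        Set.eq_empty_of_forall_notMem fun x hx => hcon ⟨x, c.plus_fst_subset h hx.2, hx.1⟩
      by_cases h1 : T ∩ F₁.A ⊆ E₁
      · refine hcon (c.attacksSet_of_trace h hS₂ hs₀ hs₁ hs₂ h₀₁ h₀₂ h₁₂ hTc (X := T ∩ F₂.A)
          (fun x hx => hA2 x hx.2) Set.subset_union_left subset_rfl
          fun Y hYA hY hTY => hd Y hYA hY ?_)
        refine ⟨T ∩ F₂.A, h.starF₂_R_subset E₁ s₀ s₁ s₂ ((h.mem_starF₂_R E₁ s₀ _ a).2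
          (Or.inr (Or.inl ⟨T, hT, Set.eq_empty_of_forall_notMem ?_, h1, rfl⟩))), hTY⟩
        rintro x ⟨hx, U, hU | hU, hUE⟩
        · exact (hfree.subset ⟨hx, U, Or.inl (Or.inl hU), hUE⟩).elim
        · exact (hfree.subset ⟨hx, U, Or.inr hU, hUE⟩).elim
      · have hU : (T, a) ∈ undecided F₁ (hatF₂ h) (hatR₃ h) E₁ := ⟨hT, hfree, h1⟩
        refine hcon (c.attacksSet_of_trace h hS₂ hs₀ hs₁ hs₂ h₀₁ h₀₂ h₁₂ hTc
          (X := T ∩ F₂.A ∪ {s₀}) ?_ subset_rfl Set.subset_union_left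
          fun Y hYA hY hTY => hd Y hYA hY ?_)
        · rintro x (hx | rfl)
          · exact hA2 x hx.2
          · exact (h.mem_circledastF₂_A E₁ _ s₁ s₂ _).2 (Or.inr (Or.inl ⟨⟨_, hU⟩, rfl⟩))
        · exact ⟨T ∩ F₂.A ∪ {s₀}, h.starF₂_R_subset E₁ s₀ s₁ s₂ ((h.mem_starF₂_R E₁ s₀ _ a).2
            (Or.inr (Or.inr (Or.inr ⟨T, hU, rfl⟩)))), hTY⟩

end Corresponds

/-! ### From the parts to the whole -/

theorem corresponds_of_adm (h : IsSplitting F F₁ F₂ R₃ S₃) {E₁ E₂ : Set α} {s₀ s₁ s₂ : α}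
    (hs₀ : s₀ ∉ F.A) (hs₂ : s₂ ∉ F.A)
    (hE₁ : E₁ ∈ F₁.adm) (hE₂ : E₂ ∈ (circledastF₂ h E₁ s₀ s₁ s₂).adm) :
    Corresponds F F₁ F₂ s₂ (E₁ ∪ (E₂ \ {s₂})) E₁ E₂ := by
  obtain ⟨⟨hE₁A, hE₁cf⟩, hE₁c, -⟩ := hE₁
  obtain ⟨⟨hE₂A, hE₂cf⟩, hE₂c, -⟩ := hE₂
  have hE₁cf' : ∀ x ∈ E₁, x ∉ plus F₁.R E₁ := fun x hx hp => hE₁cf ⟨x, hp, hx⟩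
  have hE₂cf' : ∀ x ∈ E₂, x ∉ plus (circledastF₂ h E₁ s₀ s₁ s₂).R E₂ :=
    fun x hx hp => hE₂cf ⟨x, hp, hx⟩
  have hsub : ∀ x ∈ E₂, x ∈ F₂.A ∨ x = s₂ := by
    intro x hx
    rcases (h.mem_circledastF₂_A E₁ s₀ s₁ s₂ x).1 (hE₂A hx) with
      h2 | ⟨hne, rfl⟩ | ⟨hne, rfl⟩ | ⟨-, rfl⟩
    · exact Or.inl h2
    · refine (hE₂cf' _ hx ⟨{x}, h.starF₂_R_subset E₁ _ s₁ s₂ ((h.mem_starF₂_R E₁ _ _ _).2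
        (Or.inr (Or.inr (Or.inl ⟨hne, rfl, rfl⟩)))), ?_⟩).elim
      exact Set.singleton_subset_iff.2 hx
    · exact (hE₂cf' _ hx ⟨∅, (h.mem_circledastF₂_R E₁ _ s₂ hs₀ _ _).2
        (Or.inr (Or.inl ⟨hne, rfl, rfl⟩)), Set.empty_subset _⟩).elim
    · exact Or.inr rfl
  have hs₂A2 : s₂ ∉ F₂.A := fun h2 => hs₂ (h.sub₂.1 h2)
  have hmem₂ : ∀ x ∈ F₂.A, x ∈ E₁ ∪ (E₂ \ {s₂}) → x ∈ E₂ := by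
    rintro x hx2 (hx | hx)
    · exact (h.notMem_snd (hE₁A hx) hx2).elim
    · exact hx.1
  have hmem₁ : ∀ x ∈ F₁.A, x ∈ E₁ ∪ (E₂ \ {s₂}) → x ∈ E₁ := by
    rintro x hx1 (hx | hx)
    · exact hx
    · rcases hsub x hx.1 with hx2 | hx2
      · exact (h.notMem_snd hx1 hx2).elim
      · exact (hx.2 hx2).elim
  have hinc : ∀ T ∈ incompatible F₁ S₃ E₁, ¬ T ∩ F₂.A ⊆ E₂ := by
    intro T hT hTE
    by_cases hD : T ∈ closureDefeated F₁ (starF₂ h E₁ s₀) S₃ E₁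
    · have h1 : s₁ ∈ E₂ := isClosedIn_iff.1 hE₂c (T ∩ F₂.A) s₁
        ((h.mem_circledastF₂_S E₁ s₁ s₂ hs₀ _ _).2 (Or.inr (Or.inl ⟨T, hD, rfl, rfl⟩))) hTE
      exact hE₂cf' _ h1 ⟨∅, (h.mem_circledastF₂_R E₁ s₁ s₂ hs₀ _ _).2
        (Or.inr (Or.inl ⟨⟨T, hD⟩, rfl, rfl⟩)), Set.empty_subset _⟩
    · have h2 : s₂ ∈ E₂ := isClosedIn_iff.1 hE₂c (T ∩ F₂.A) s₂
        ((h.mem_circledastF₂_S E₁ s₁ s₂ hs₀ _ _).2 (Or.inr (Or.inr ⟨T, ⟨hT, hD⟩, rfl, rfl⟩))) hTE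
      exact hE₂cf' _ h2 ⟨T ∩ F₂.A ∪ {s₂}, (h.mem_circledastF₂_R E₁ s₁ s₂ hs₀ _ _).2
        (Or.inr (Or.inr ⟨T, ⟨hT, hD⟩, rfl, rfl⟩)),
        Set.union_subset hTE (Set.singleton_subset_iff.2 h2)⟩
  have hEA : E₁ ∪ (E₂ \ {s₂}) ⊆ F.A := by
    rintro x (hx | hx)
    · exact h.sub₁.1 (hE₁A hx)
    · exact (hsub x hx.1).elim (fun h2 => h.sub₂.1 h2) fun h2 => (hx.2 h2).elim
  have hclosed : F.IsClosedIn (E₁ ∪ (E₂ \ {s₂})) := by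
    refine isClosedIn_iff.2 fun T a hT hTE => ?_
    rw [h.S_eq] at hT
    rcases hT with (hT | hT) | hT
    · exact Or.inl (isClosedIn_iff.1 hE₁c T a hT fun x hx =>
        hmem₁ x ((F₁.S_sub _ hT).1 hx) (hTE hx))
    · refine Or.inr ⟨isClosedIn_iff.1 hE₂c T a
        ((h.mem_circledastF₂_S E₁ s₁ s₂ hs₀ _ _).2 (Or.inl hT)) fun x hx =>
          hmem₂ x ((F₂.S_sub _ hT).1 hx) (hTE hx), ?_⟩
      rintro rfl
      exact hs₂A2 (F₂.S_sub _ hT).2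
    · refine Or.inl (by_contra fun ha => ?_)
      exact hinc T ⟨a, (h.S₃_sub hT).2.2.2, hT, fun x hx => hmem₁ x hx.2 (hTE hx.1), ha⟩
        fun x hx => hmem₂ x hx.2 (hTE hx.1)
  refine ⟨⟨hEA, ?_⟩, hclosed, ?_, ?_, hsub⟩
  · rintro ⟨a, hap, haE⟩
    rcases h.mem_or (hEA haE) with ha1 | ha2
    · refine hE₁cf' a (hmem₁ a ha1 haE) ?_
      exact plus_mono (fun x hx => hmem₁ x hx.2 hx.1) ((h.mem_plus_fst ha1).1 hap)
    · -- An attack that the R-reduct discards would require `E₁` to attack `E₂`; this attack has its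
      -- tail in `A₁`, hence it survives in the R-reduct with an empty tail.
      have hfirst : ∀ x ∈ E₁ ∪ (E₂ \ {s₂}), x ∉ plus (F₁.R ∪ hatR₃ h) E₁ := by
        rintro x hx ⟨T, hT | hT, hTE⟩
        · exact hE₁cf' x (hmem₁ x (F₁.R_sub _ hT).2 hx) ⟨T, hT, hTE⟩
        · have hx2 := (h.mem_hatR₃ hT).2.1
          refine hE₂cf' x (hmem₂ x hx2 hx) ⟨T ∩ F₂.A, h.starF₂_R_subset E₁ s₀ s₁ s₂
            ((h.mem_starF₂_R E₁ s₀ _ x).2 (Or.inr (Or.inl ⟨T, hT, ?_, fun y hy => hTE hy.1, rfl⟩))),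
            fun y hy => (h.notMem_snd (hE₁A (hTE hy.1)) hy.2).elim⟩
          refine Set.eq_empty_of_forall_notMem ?_
          rintro y ⟨hy, U, hU | hU, hUE⟩
          · exact hE₁cf' y (hTE hy) ⟨U, hU, hUE⟩
          · exact h.notMem_snd (hE₁A (hTE hy)) (h.mem_hatR₃ hU).2.1
      refine hE₂cf' a (hmem₂ a ha2 haE) ?_
      obtain ⟨T, hTE, hT | hT⟩ := h.exists_closed_attack hclosed ha2 hap
      · exact ⟨T, h.starF₂_R_subset E₁ s₀ s₁ s₂ ((h.mem_starF₂_R E₁ s₀ T a).2 (Or.inl hT)),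
          fun x hx => hmem₂ x ((h.mem_hatF₂ hT).1 hx) (hTE hx)⟩
      · exact ⟨T ∩ F₂.A, h.starF₂_R_subset E₁ s₀ s₁ s₂ ((h.mem_starF₂_R E₁ s₀ _ a).2
          (Or.inr (Or.inl ⟨T, hT, Set.eq_empty_of_forall_notMem fun x hx =>
            hfirst x (hTE hx.1) hx.2, fun x hx => hmem₁ x hx.2 (hTE hx.1), rfl⟩))),
          fun x hx => hmem₂ x hx.2 (hTE hx.1)⟩
  · exact Set.Subset.antisymm (fun x hx => ⟨Or.inl hx, hE₁A hx⟩) fun x hx => hmem₁ x hx.2 hx.1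
  · refine Set.Subset.antisymm (fun x hx => ⟨hmem₂ x hx.2 hx.1, hx.2⟩)
      fun x hx => ⟨Or.inr ⟨hx.1, ?_⟩, hx.2⟩
    rintro rfl
    exact hs₂A2 hx.2

theorem union_mem_adm (h : IsSplitting F F₁ F₂ R₃ S₃) (hS₂ : ∀ a, (∅, a) ∉ F₂.S)
    {E₁ E₂ : Set α} {s₀ s₁ s₂ : α} (hs₀ : s₀ ∉ F.A) (hs₁ : s₁ ∉ F.A) (hs₂ : s₂ ∉ F.A)
    (h₀₁ : s₀ ≠ s₁) (h₀₂ : s₀ ≠ s₂) (h₁₂ : s₁ ≠ s₂)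
    (hE₁ : E₁ ∈ F₁.adm) (hE₂ : E₂ ∈ (circledastF₂ h E₁ s₀ s₁ s₂).adm) :
    E₁ ∪ (E₂ \ {s₂}) ∈ F.adm := by
  have c := corresponds_of_adm h hs₀ hs₂ hE₁ hE₂
  refine ⟨c.cf, c.closed, fun a ha => ?_⟩
  rcases h.mem_or (c.cf.1 ha) with ha1 | ha2
  · exact (Corresponds.defends_fst h hS₂ c.fst ha1).2 (hE₁.2.2 a (c.fst.symm.subset ⟨ha, ha1⟩))
  · exact (c.defends_snd h hS₂ hs₀ hs₁ hs₂ h₀₁ h₀₂ h₁₂ ha2).2 (hE₂.2.2 a ((c.mem_snd ha2).2 ha))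

/-! ### From the whole to the parts -/

/-- The trace on `A₂` of a set `E` of `F`, together with `s₂` if this is an argument of `G` defended
by the trace. -/
def sndPart (F₂ G : BSAF α) (s₂ : α) (E : Set α) : Set α :=
  E ∩ F₂.A ∪ {x | x = s₂ ∧ s₂ ∈ G.A ∧ G.Defends (E ∩ F₂.A) s₂}

theorem sndPart_eq (F₂ G : BSAF α) (s₂ : α) (E : Set α) :
    sndPart F₂ G s₂ E = E ∩ F₂.A ∨ sndPart F₂ G s₂ E = E ∩ F₂.A ∪ {s₂} := by
  by_cases hc : s₂ ∈ G.A ∧ G.Defends (E ∩ F₂.A) s₂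
  · right
    ext x
    simp [sndPart, hc]
  · left
    ext x
    simp only [sndPart, Set.mem_union, Set.mem_ofPred_eq]
    tauto

/-- Adding `s₂` or not does not affect the correspondence. -/
theorem corresponds_of_subset (h : IsSplitting F F₁ F₂ R₃ S₃) {E E₂ : Set α} {s₂ : α}
    (hs₂ : s₂ ∉ F.A) (hcf : E ∈ F.cf) (hcl : F.IsClosedIn E) (h1 : E ∩ F₂.A ⊆ E₂)
    (h2 : E₂ ⊆ E ∩ F₂.A ∪ {s₂}) : Corresponds F F₁ F₂ s₂ E (E ∩ F₁.A) E₂ := by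
  refine ⟨hcf, hcl, rfl, Set.Subset.antisymm (fun x hx => ⟨h1 hx, hx.2⟩) ?_, fun x hx => ?_⟩
  · rintro x ⟨hx, hx2⟩
    rcases h2 hx with hx' | rfl
    · exact hx'
    · exact (hs₂ (h.sub₂.1 hx2)).elim
  · exact (h2 hx).imp (fun hx => hx.2) id

section Whole

variable {E E₁ : Set α} {s₀ s₁ s₂ : α}

theorem corresponds_sndPart (h : IsSplitting F F₁ F₂ R₃ S₃) (hs₂ : s₂ ∉ F.A) (hE : E ∈ F.adm)
    (G : BSAF α) : Corresponds F F₁ F₂ s₂ E (E ∩ F₁.A) (sndPart F₂ G s₂ E) :=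
  corresponds_of_subset h hs₂ hE.1 hE.2.1 Set.subset_union_left
    (Set.union_subset_union_right _ fun _ hx => hx.1)

/-- The trace on `A₂` defends the same arguments of `F₂⊛` with and without `s₂`. -/
theorem defends_sndPart (h : IsSplitting F F₁ F₂ R₃ S₃) (hs₀ : s₀ ∉ F.A) (hs₂ : s₂ ∉ F.A)
    (h₀₂ : s₀ ≠ s₂) (hE : E ∈ F.adm) {a : α} :
    (circledastF₂ h (E ∩ F₁.A) s₀ s₁ s₂).Defends
        (sndPart F₂ (circledastF₂ h (E ∩ F₁.A) s₀ s₁ s₂) s₂ E) a ↔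
      (circledastF₂ h (E ∩ F₁.A) s₀ s₁ s₂).Defends (E ∩ F₂.A) a := by
  set G := circledastF₂ h (E ∩ F₁.A) s₀ s₁ s₂
  have c := corresponds_sndPart (F₁ := F₁) (F₂ := F₂) h hs₂ hE G
  have c' : Corresponds F F₁ F₂ s₂ E (E ∩ F₁.A) (E ∩ F₂.A) :=
    corresponds_of_subset h hs₂ hE.1 hE.2.1 subset_rfl Set.subset_union_left
  have hplus : plus G.R (sndPart F₂ G s₂ E) ⊆ plus G.R (E ∩ F₂.A) := by
    intro x hx
    rcases c.mem_plus_of_circledast h hs₀ h₀₂ hx with ⟨hx2, hp⟩ | ⟨rfl, hne⟩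
    · exact c'.mem_plus_circledast h hx2 hp
    · exact ⟨∅, (h.mem_circledastF₂_R _ _ s₂ hs₀ _ _).2 (Or.inr (Or.inl ⟨hne, rfl, rfl⟩)),
        Set.empty_subset _⟩
  constructor
  · intro hd Y hYA hY ha
    exact (hd Y hYA hY ha).mono (Set.inter_subset_inter_left _ hplus)
  · intro hd Y hYA hY ha
    exact (hd Y hYA hY ha).mono (Set.inter_subset_inter_left _ (plus_mono Set.subset_union_left))

theorem fst_mem_adm (h : IsSplitting F F₁ F₂ R₃ S₃) (hS₂ : ∀ a, (∅, a) ∉ F₂.S) (hE : E ∈ F.adm) :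
    E ∩ F₁.A ∈ F₁.adm := by
  refine ⟨⟨Set.inter_subset_right, ?_⟩, h.isClosedIn_fst hE.2.1, fun a ha => ?_⟩
  · rintro ⟨x, hx, hxE⟩
    exact hE.1.2 ⟨x, (h.mem_plus_fst hxE.2).2 hx, hxE.1⟩
  · exact (Corresponds.defends_fst h hS₂ rfl ha.2).1 (hE.2.2 a ha.1)

theorem sndPart_mem_adm (h : IsSplitting F F₁ F₂ R₃ S₃) (hS₂ : ∀ a, (∅, a) ∉ F₂.S)
    (hs₀ : s₀ ∉ F.A) (hs₁ : s₁ ∉ F.A) (hs₂ : s₂ ∉ F.A)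
    (h₀₁ : s₀ ≠ s₁) (h₀₂ : s₀ ≠ s₂) (h₁₂ : s₁ ≠ s₂) (hE : E ∈ F.adm) :
    sndPart F₂ (circledastF₂ h (E ∩ F₁.A) s₀ s₁ s₂) s₂ E ∈
      (circledastF₂ h (E ∩ F₁.A) s₀ s₁ s₂).adm := by
  have hdef := fun a => defends_sndPart (s₁ := s₁) (a := a) h hs₀ hs₂ h₀₂ hE
  set G := circledastF₂ h (E ∩ F₁.A) s₀ s₁ s₂
  have c := corresponds_sndPart (F₁ := F₁) (F₂ := F₂) h hs₂ hE G
  refine ⟨⟨?_, ?_⟩, isClosedIn_iff.2 fun T a hT hTE => ?_, ?_⟩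
  · rintro x (hx | ⟨rfl, hx, -⟩)
    · exact (h.mem_circledastF₂_A _ s₀ s₁ s₂ x).2 (Or.inl hx.2)
    · exact hx
  · rintro ⟨x, hx, hxE⟩
    rcases c.mem_plus_of_circledast h hs₀ h₀₂ hx with ⟨hx2, hp⟩ | ⟨rfl, -⟩
    · exact c.not_mem_plus ((c.mem_snd hx2).1 hxE) hp
    · rcases c.sub _ hxE with hx2 | hx2
      · exact hs₁ (h.sub₂.1 hx2)
      · exact h₁₂ hx2
  · rcases (h.mem_circledastF₂_S _ s₁ s₂ hs₀ T a).1 hT with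
      hT | ⟨T', hT', rfl, -⟩ | ⟨T', hT', rfl, -⟩
    · have ha2 := (F₂.S_sub _ hT).2
      refine (c.mem_snd ha2).2 (isClosedIn_iff.1 hE.2.1 T a (h.sub₂.2.2 hT) fun x hx => ?_)
      exact (c.mem_snd ((F₂.S_sub _ hT).1 hx)).1 (hTE hx)
    · exact (c.not_subset_of_incompatible h hT'.1 hTE).elim
    · exact (c.not_subset_of_incompatible h hT'.1 hTE).elim
  · rintro a (ha | ⟨rfl, -, hd⟩)
    · exact (c.defends_snd h hS₂ hs₀ hs₁ hs₂ h₀₁ h₀₂ h₁₂ ha.2).1 (hE.2.2 a ha.1)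
    · exact (hdef _).2 hd

theorem sndPart_mem_com (h : IsSplitting F F₁ F₂ R₃ S₃) (hS₂ : ∀ a, (∅, a) ∉ F₂.S)
    (hs₀ : s₀ ∉ F.A) (hs₁ : s₁ ∉ F.A) (hs₂ : s₂ ∉ F.A)
    (h₀₁ : s₀ ≠ s₁) (h₀₂ : s₀ ≠ s₂) (h₁₂ : s₁ ≠ s₂) (hE : E ∈ F.com) :
    sndPart F₂ (circledastF₂ h (E ∩ F₁.A) s₀ s₁ s₂) s₂ E ∈
      (circledastF₂ h (E ∩ F₁.A) s₀ s₁ s₂).com := by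
  refine ⟨sndPart_mem_adm h hS₂ hs₀ hs₁ hs₂ h₀₁ h₀₂ h₁₂ hE.1, fun a ha hd => ?_⟩
  have hdef := (defends_sndPart (s₁ := s₁) (a := a) h hs₀ hs₂ h₀₂ hE.1).1 hd
  set G := circledastF₂ h (E ∩ F₁.A) s₀ s₁ s₂
  have c := corresponds_sndPart (F₁ := F₁) (F₂ := F₂) h hs₂ hE.1 G
  -- Supports of `F₂⊛` have nonempty tails in `A₂`, so `{s₀}` and `∅` are closed attackers of
  -- `s₀` and `s₁`.
  have hclosed : ∀ X : Set α, X ∩ F₂.A = ∅ → G.IsClosedIn X := fun X hX =>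
    isClosedIn_iff.2 fun T b hT hTX => by
      obtain ⟨hT2, x, hx⟩ := h.circledastF₂_S_tail hS₂ hs₀ hT
      exact (hX.subset ⟨hTX hx, hT2 hx⟩).elim
  rcases (h.mem_circledastF₂_A _ s₀ s₁ s₂ a).1 ha with
    ha2 | ⟨hne, rfl⟩ | ⟨hne, rfl⟩ | ⟨-, rfl⟩
  · refine (c.mem_snd ha2).2 (hE.2 a (h.sub₂.1 ha2) ?_)
    exact (c.defends_snd h hS₂ hs₀ hs₁ hs₂ h₀₁ h₀₂ h₁₂ ha2).2 hd
  · obtain ⟨x, hx, hxa⟩ := hd {a} (Set.singleton_subset_iff.2 ha)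
      (hclosed _ (Set.eq_empty_of_forall_notMem fun x hx => hs₀ (h.sub₂.1 (hx.1 ▸ hx.2))))
      ⟨{a}, h.starF₂_R_subset _ _ s₁ s₂ ((h.mem_starF₂_R _ _ _ _).2
        (Or.inr (Or.inr (Or.inl ⟨hne, rfl, rfl⟩)))), subset_rfl⟩
    obtain rfl : x = a := hxa
    rcases c.mem_plus_of_circledast h hs₀ h₀₂ hx with ⟨hx2, -⟩ | ⟨hx1, -⟩
    · exact (hs₀ (h.sub₂.1 hx2)).elim
    · exact (h₀₁ hx1).elim
  · obtain ⟨x, -, hx⟩ := hd ∅ (Set.empty_subset _) (hclosed _ (Set.empty_inter _))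
      ⟨∅, (h.mem_circledastF₂_R _ _ s₂ hs₀ _ _).2 (Or.inr (Or.inl ⟨hne, rfl, rfl⟩)), subset_rfl⟩
    exact hx.elim
  · exact Or.inr ⟨rfl, ha, hdef⟩

theorem sndPart_mem_stb (h : IsSplitting F F₁ F₂ R₃ S₃) (hS₂ : ∀ a, (∅, a) ∉ F₂.S)
    (hs₀ : s₀ ∉ F.A) (hs₁ : s₁ ∉ F.A) (hs₂ : s₂ ∉ F.A)
    (h₀₁ : s₀ ≠ s₁) (h₀₂ : s₀ ≠ s₂) (h₁₂ : s₁ ≠ s₂) (hE : E ∈ F.stb) :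
    sndPart F₂ (circledastF₂ h (E ∩ F₁.A) s₀ s₁ s₂) s₂ E ∈
      (circledastF₂ h (E ∩ F₁.A) s₀ s₁ s₂).stb := by
  refine ⟨sndPart_mem_adm h hS₂ hs₀ hs₁ hs₂ h₀₁ h₀₂ h₁₂ hE.1, fun a ha => ?_⟩
  set G := circledastF₂ h (E ∩ F₁.A) s₀ s₁ s₂
  have c := corresponds_sndPart (F₁ := F₁) (F₂ := F₂) h hs₂ hE.1 G
  obtain ⟨ha, haE⟩ := ha
  rcases (h.mem_circledastF₂_A _ s₀ s₁ s₂ a).1 ha with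
    ha2 | ⟨⟨p, hp⟩, rfl⟩ | ⟨hne, rfl⟩ | ⟨-, rfl⟩
  · exact c.mem_plus_circledast h ha2 (hE.2 a ⟨h.sub₂.1 ha2, fun h2 => haE ((c.mem_snd ha2).2 h2)⟩)
  · -- A stable set leaves no link undecided.
    obtain ⟨x, hx, hxE⟩ := Set.not_subset.1 hp.2.2
    have hxp : x ∈ plus F.R E := hE.2 x ⟨h.sub₁.1 hx.2, fun hxE' => hxE ⟨hxE', hx.2⟩⟩
    obtain ⟨T, hT, hTE⟩ := (h.mem_plus_fst hx.2).1 hxp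
    exact (hp.2.1.subset ⟨hx.1, T, Or.inl (Or.inl hT), hTE⟩).elim
  · exact ⟨∅, (h.mem_circledastF₂_R _ _ s₂ hs₀ _ _).2 (Or.inr (Or.inl ⟨hne, rfl, rfl⟩)),
      Set.empty_subset _⟩
  · -- A stable set defends `s₂`: it omits, hence attacks, a member of each tail attacking `s₂`.
    have c' : Corresponds F F₁ F₂ a E (E ∩ F₁.A) (E ∩ F₂.A) :=
      corresponds_of_subset h hs₂ hE.1.1 hE.1.2.1 subset_rfl Set.subset_union_left
    refine (haE (Or.inr ⟨rfl, ha, fun Y hYA hY haY => ?_⟩)).elim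
    obtain ⟨T, hT, hTY⟩ := haY
    rcases (h.mem_circledastF₂_R _ s₁ a hs₀ T a).1 hT with
      hT | ⟨-, -, rfl⟩ | ⟨T', hT', rfl, -⟩
    · rcases ((starF₂ h (E ∩ F₁.A) s₀).R_sub _ hT).2 with ha2 | ⟨-, ha0⟩
      · exact (hs₂ (h.sub₂.1 ha2)).elim
      · exact (h₀₂ ha0.symm).elim
    · exact (h₁₂ rfl).elim
    · obtain ⟨x, hx, hxE⟩ := Set.not_subset.1 (c'.not_subset_of_incompatible h hT'.1)
      have hxp : x ∈ plus F.R E := hE.2 x ⟨h.sub₂.1 hx.2, fun hxE' => hxE ⟨hxE', hx.2⟩⟩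
      exact ⟨x, c'.mem_plus_circledast h hx.2 hxp, hTY (Or.inl hx)⟩

end Whole

end Splitting

end BSAF

theorem mainTheorem2 {α : Type*} (F F₁ F₂ : BSAF α) (R₃ S₃ : Set (Link α))
    (h : BSAF.IsSplitting F F₁ F₂ R₃ S₃)
    (hS₂ : ∀ a, (∅, a) ∉ F₂.S)
    (s₀ s₁ s₂ : α) (hs₀ : s₀ ∉ F.A) (hs₁ : s₁ ∉ F.A) (hs₂ : s₂ ∉ F.A)
    (h₀₁ : s₀ ≠ s₁) (h₀₂ : s₀ ≠ s₂) (h₁₂ : s₁ ≠ s₂)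
    (σ : BSAF α → Set (Set α))
    (hσ : σ = BSAF.stb ∨ σ = BSAF.adm ∨ σ = BSAF.com) :
    (∀ E₁ ∈ σ F₁, ∀ E₂ ∈ σ (BSAF.circledastF₂ h E₁ s₀ s₁ s₂),
      E₁ ∪ (E₂ \ {s₂}) ∈ σ F) ∧
    (∀ E ∈ σ F,
      E ∩ F₁.A ∈ σ F₁ ∧
      (E ∩ F₂.A ∈ σ (BSAF.circledastF₂ h (E ∩ F₁.A) s₀ s₁ s₂) ∨
        (E ∩ F₂.A) ∪ {s₂} ∈ σ (BSAF.circledastF₂ h (E ∩ F₁.A) s₀ s₁ s₂))) := by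
  have hA2 : ∀ E₁, ∀ x ∈ F₂.A, x ∈ (BSAF.circledastF₂ h E₁ s₀ s₁ s₂).A := fun E₁ x hx =>
    (h.mem_circledastF₂_A E₁ s₀ s₁ s₂ x).2 (Or.inl hx)
  have hpart : ∀ E, BSAF.sndPart F₂ (BSAF.circledastF₂ h (E ∩ F₁.A) s₀ s₁ s₂) s₂ E ∈
        σ (BSAF.circledastF₂ h (E ∩ F₁.A) s₀ s₁ s₂) →
      E ∩ F₂.A ∈ σ (BSAF.circledastF₂ h (E ∩ F₁.A) s₀ s₁ s₂) ∨
        (E ∩ F₂.A) ∪ {s₂} ∈ σ (BSAF.circledastF₂ h (E ∩ F₁.A) s₀ s₁ s₂) := by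
    intro E hE
    rcases BSAF.sndPart_eq F₂ (BSAF.circledastF₂ h (E ∩ F₁.A) s₀ s₁ s₂) s₂ E with e | e
    · exact Or.inl (e ▸ hE)
    · exact Or.inr (e ▸ hE)
  rcases hσ with rfl | rfl | rfl
  · refine ⟨fun E₁ hE₁ E₂ hE₂ => ⟨BSAF.union_mem_adm h hS₂ hs₀ hs₁ hs₂ h₀₁ h₀₂ h₁₂ hE₁.1 hE₂.1,
      fun a ha => ?_⟩, fun E hE => ⟨⟨BSAF.fst_mem_adm h hS₂ hE.1, fun a ha => ?_⟩,
      hpart E (BSAF.sndPart_mem_stb h hS₂ hs₀ hs₁ hs₂ h₀₁ h₀₂ h₁₂ hE)⟩⟩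
    · have c := BSAF.corresponds_of_adm h hs₀ hs₂ hE₁.1 hE₂.1
      rcases h.mem_or ha.1 with ha1 | ha2
      · rw [h.mem_plus_fst ha1, ← c.fst]
        exact hE₁.2 a ⟨ha1, fun haE => ha.2 (Or.inl haE)⟩
      · have hap := hE₂.2 a ⟨hA2 E₁ a ha2, fun haE => ha.2 ((c.mem_snd ha2).1 haE)⟩
        rcases c.mem_plus_of_circledast h hs₀ h₀₂ hap with ⟨-, hp⟩ | ⟨rfl, -⟩
        · exact hp
        · exact (hs₁ ha.1).elim
    · exact (h.mem_plus_fst ha.1).1 (hE.2 a ⟨h.sub₁.1 ha.1, fun haE => ha.2 ⟨haE, ha.1⟩⟩)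
  · exact ⟨fun E₁ hE₁ E₂ hE₂ => BSAF.union_mem_adm h hS₂ hs₀ hs₁ hs₂ h₀₁ h₀₂ h₁₂ hE₁ hE₂,
      fun E hE => ⟨BSAF.fst_mem_adm h hS₂ hE,
        hpart E (BSAF.sndPart_mem_adm h hS₂ hs₀ hs₁ hs₂ h₀₁ h₀₂ h₁₂ hE)⟩⟩
  · refine ⟨fun E₁ hE₁ E₂ hE₂ => ⟨BSAF.union_mem_adm h hS₂ hs₀ hs₁ hs₂ h₀₁ h₀₂ h₁₂ hE₁.1 hE₂.1,
      fun a ha hd => ?_⟩, fun E hE => ⟨⟨BSAF.fst_mem_adm h hS₂ hE.1, fun a ha hd => ?_⟩,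
      hpart E (BSAF.sndPart_mem_com h hS₂ hs₀ hs₁ hs₂ h₀₁ h₀₂ h₁₂ hE)⟩⟩
    · have c := BSAF.corresponds_of_adm h hs₀ hs₂ hE₁.1 hE₂.1
      rcases h.mem_or ha with ha1 | ha2
      · exact Or.inl (hE₁.2 a ha1 ((BSAF.Corresponds.defends_fst h hS₂ c.fst ha1).1 hd))
      · refine (c.mem_snd ha2).1 (hE₂.2 a (hA2 E₁ a ha2) ?_)
        exact (c.defends_snd h hS₂ hs₀ hs₁ hs₂ h₀₁ h₀₂ h₁₂ ha2).1 hd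
    · exact ⟨hE.2 a (h.sub₁.1 ha) ((BSAF.Corresponds.defends_fst h hS₂ rfl ha).2 hd), ha⟩
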